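/- Let $G$ be a finite simple graph and $p>0$ a real number. The *fractional brushing game* with parameter $p$ on $G$ is played by Min and Max. Initially every vertex is dirty and carries no brushes. The players alternate turns, Min first; on each turn the player adds one brush to a dirty vertex of his or her choice. Whenever the number of brushes on a dirty vertex $v$ is at least $p$ times the number of dirty neighbors of $v$, the vertex $v$ *fires*: it sends $p$ brushes to each of its dirty neighbors and becomes clean. Firings continue, one at a time, until no dirty vertex can fire (the order of the firings does not affect the resulting set of dirty vertices or the brushes on them); then the next turn is played. The game ends when all vertices are clean. Min wants to minimize, and Max to maximize, the number of turns played; the number of turns under optimal play by both is denoted $b_{g,p}(G)$. For $p=1$ this is the ordinary brushing game, and $b_g(G)=b_{g,1}(G)$ is the game brush number of $G$. Let $p=p(n)>0$ satisfy $p(n)\gg \ln n/n$, that is, $\dfrac{\ln n}{n\,p(n)}\to 0$ as $n\to\infty$. Then, for the complete graph $K_n$, as $n\to\infty$, $$b_{g,p(n)}(K_n)=(1+o(1))\,p(n)\,b_g(K_n)=(1+o(1))\,\frac{p(n)\,n^2}{e}.$$ -/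

import Mathlib

/-- The two players. -/
inductive Player where
  | min
  | max

/-- A position of a brushing game: the set of dirty vertices and the number of brushes on each
vertex (real, since in the fractional game vertices need not hold whole numbers of brushes). -/
structure BrushPosition (V : Type*) where
  dirty : Finset V
  brushes : V → ℝ

namespace BrushPosition

variable {V : Type*} [DecidableEq V]

/-- The dirty neighbours of `v`. -/
def dirtyNeighbors (G : SimpleGraph V) [DecidableRel G.Adj] (s : BrushPosition V) (v : V) :
    Finset V :=
  s.dirty.filter (fun w => G.Adj v w)

/-- A dirty vertex is ready to fire when the number of brushes on it is at least `p` times the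
number of its dirty neighbours. -/
def Ready (p : ℝ) (G : SimpleGraph V) [DecidableRel G.Adj] (s : BrushPosition V) (v : V) : Prop :=
  v ∈ s.dirty ∧ p * ((s.dirtyNeighbors G v).card : ℝ) ≤ s.brushes v

/-- The vertex `v` fires: it sends `p` brushes to each dirty neighbour and becomes clean. -/
def fire (p : ℝ) (G : SimpleGraph V) [DecidableRel G.Adj] (s : BrushPosition V) (v : V) :
    BrushPosition V where
  dirty := s.dirty.erase v
  brushes := fun w =>
    if w = v then s.brushes v - p * ((s.dirtyNeighbors G v).card : ℝ)
    else if w ∈ s.dirtyNeighbors G v then s.brushes w + p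
    else s.brushes w

open Classical in
/-- Vertices fire, one at a time, until no dirty vertex is ready.  The order of the firings, which
does not influence the final set of dirty vertices or the brushes on them, is fixed by choice. -/
noncomputable def stabilize (p : ℝ) (G : SimpleGraph V) [DecidableRel G.Adj]
    (s : BrushPosition V) : BrushPosition V :=
  if h : ∃ v, s.Ready p G v then stabilize p G (s.fire p G h.choose) else s
termination_by s.dirty.card
decreasing_by exact Finset.card_erase_lt_of_mem h.choose_spec.1

/-- Put one brush on `v`. -/
def place (s : BrushPosition V) (v : V) : BrushPosition V where
  dirty := s.dirty
  brushes := fun w => if w = v then s.brushes w + 1 else s.brushes w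

/-- A turn: a brush is put on `v`, then all firings that this causes take place. -/
noncomputable def move (p : ℝ) (G : SimpleGraph V) [DecidableRel G.Adj] (s : BrushPosition V)
    (v : V) : BrushPosition V :=
  (s.place v).stabilize p G

/-- The initial position: every vertex is dirty and there are no brushes (vertices that are ready
with no brush at all, that is, isolated vertices, fire at once). -/
noncomputable def start (p : ℝ) (G : SimpleGraph V) [Fintype V] [DecidableRel G.Adj] :
    BrushPosition V :=
  stabilize p G { dirty := Finset.univ, brushes := fun _ => 0 }

/-- `s.MinForces p G k P`: from the position `s` with player `P` to move, Min has a strategy by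
which the game, in which the players alternately put a brush on a dirty vertex of their choice,
ends (every vertex is clean) after at most `k` further turns, however Max plays. -/
def MinForces (p : ℝ) (G : SimpleGraph V) [DecidableRel G.Adj] :
    ℕ → Player → BrushPosition V → Prop
  | 0, _, s => s.dirty = ∅
  | k + 1, .min, s => s.dirty = ∅ ∨ ∃ v ∈ s.dirty, MinForces p G k .max (s.move p G v)
  | k + 1, .max, s => s.dirty = ∅ ∨ ∀ v ∈ s.dirty, MinForces p G k .min (s.move p G v)

end BrushPosition

/-- The length (number of brushes played) of the Min-start fractional brushing game with
parameter `p` on `G` under optimal play: the least `k` such that Min can force the end of the game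
within `k` turns.  For `p ≥ 0` such a `k` exists, see `exists_minForces_start`. -/
noncomputable def fractionalGameBrushNumber {V : Type*} [Fintype V] [DecidableEq V] (p : ℝ)
    (G : SimpleGraph V) [DecidableRel G.Adj] : ℕ :=
  sInf {k : ℕ | BrushPosition.MinForces p G k .min (BrushPosition.start p G)}

/-- The game brush number.  In the ordinary game a vertex fires when it has at least as many
brushes as dirty neighbours, and it then sends one brush to each: these are the rules for
`p = 1`. -/
noncomputable def gameBrushNumber {V : Type*} [Fintype V] [DecidableEq V]
    (G : SimpleGraph V) [DecidableRel G.Adj] : ℕ :=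
  fractionalGameBrushNumber 1 G

namespace BrushPosition

variable {V : Type*} [DecidableEq V]

theorem stabilize_spec (p : ℝ) (hp : 0 ≤ p) (G : SimpleGraph V) [DecidableRel G.Adj]
    (s : BrushPosition V) :
    (∀ v, ¬ (s.stabilize p G).Ready p G v) ∧ (s.stabilize p G).dirty ⊆ s.dirty ∧
      ∀ v ∈ (s.stabilize p G).dirty, s.brushes v ≤ (s.stabilize p G).brushes v := by
  induction hn : s.dirty.card using Nat.strong_induction_on generalizing s with
  | _ n ih =>
    subst hn
    rw [stabilize]
    split_ifs with h
    · have hlt := Finset.card_erase_lt_of_mem h.choose_spec.1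
      obtain ⟨h1, h2, h3⟩ := ih _ hlt (s.fire p G h.choose) rfl
      refine ⟨h1, h2.trans (Finset.erase_subset _ _), fun v hv => le_trans ?_ (h3 v hv)⟩
      have hne : v ≠ h.choose := Finset.ne_of_mem_erase (h2 hv)
      simp only [fire, if_neg hne]
      split_ifs <;> linarith
    · exact ⟨fun v hv => h ⟨v, hv⟩, subset_rfl, fun v _ => le_rfl⟩

/-- The game ends after boundedly many turns, whatever the players do. -/
theorem exists_minForces_start [Fintype V] (p : ℝ) (hp : 0 ≤ p) (G : SimpleGraph V)
    [DecidableRel G.Adj] : ∃ k, MinForces p G k .min (start p G) := by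
  let d : BrushPosition V → V → ℕ := fun s v => ⌈p * (Fintype.card V : ℝ) - s.brushes v⌉₊
  let Φ : BrushPosition V → ℕ := fun s => ∑ v ∈ s.dirty, d s v
  have hpos : ∀ s : BrushPosition V, (∀ v, ¬ s.Ready p G v) → ∀ v ∈ s.dirty,
      0 < p * (Fintype.card V : ℝ) - s.brushes v := by
    intro s hs v hv
    have h1 : s.brushes v < p * ((s.dirtyNeighbors G v).card : ℝ) := by
      by_contra hc
      exact hs v ⟨hv, not_lt.mp hc⟩
    have h2 : ((s.dirtyNeighbors G v).card : ℝ) ≤ Fintype.card V := by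
      exact_mod_cast Finset.card_le_univ _
    nlinarith [mul_le_mul_of_nonneg_left h2 hp]
  have hmove : ∀ s : BrushPosition V, (∀ v, ¬ s.Ready p G v) → ∀ v ∈ s.dirty,
      (∀ w, ¬ (s.move p G v).Ready p G w) ∧ Φ (s.move p G v) < Φ s := by
    intro s hs v hv
    obtain ⟨h1, h2, h3⟩ := stabilize_spec p hp G (s.place v)
    refine ⟨h1, ?_⟩
    have hle : Φ (s.move p G v) ≤ ∑ w ∈ s.dirty, d (s.place v) w := by
      refine le_trans (Finset.sum_le_sum fun w hw => ?_)
        (Finset.sum_le_sum_of_subset (f := d (s.place v)) h2)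
      exact Nat.ceil_mono (sub_le_sub_left (h3 w hw) _)
    refine lt_of_le_of_lt hle (Finset.sum_lt_sum (fun w _ => ?_) ⟨v, hv, ?_⟩)
    · refine Nat.ceil_mono ?_
      simp only [place]
      split_ifs <;> linarith
    · have hx := hpos s hs v hv
      have hd : 0 < d s v := Nat.ceil_pos.mpr hx
      have : d (s.place v) v ≤ d s v - 1 := by
        refine Nat.ceil_le.mpr ?_
        have hc : p * (Fintype.card V : ℝ) - s.brushes v ≤ (d s v : ℝ) := Nat.le_ceil _
        rw [Nat.cast_sub hd]
        simp only [place, if_true, Nat.cast_one]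
        linarith
      omega
  have key : ∀ k P (s : BrushPosition V), (∀ v, ¬ s.Ready p G v) → Φ s ≤ k →
      MinForces p G k P s := by
    intro k
    induction k with
    | zero =>
      intro P s hs hk
      rw [MinForces]
      by_contra hne
      obtain ⟨v, hv⟩ := Finset.nonempty_iff_ne_empty.mpr hne
      have := (hmove s hs v hv).2
      omega
    | succ k ih =>
      intro P s hs hk
      cases P with
      | min =>
        rw [MinForces]
        rcases s.dirty.eq_empty_or_nonempty with h | ⟨v, hv⟩
        · exact Or.inl h
        · have := hmove s hs v hv
          exact Or.inr ⟨v, hv, ih _ _ this.1 (by omega)⟩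
      | max =>
        rw [MinForces]
        refine Or.inr fun v hv => ?_
        have := hmove s hs v hv
        exact ih _ _ this.1 (by omega)
  exact ⟨_, key _ _ _ (stabilize_spec p hp G _).1 le_rfl⟩

end BrushPosition

/-!
On `K_n` all dirty vertices receive the same number of brushes from the clean ones, so a position is
determined by the set of dirty vertices and the brushes that the players have placed on them, and a
vertex can fire when `m` vertices are dirty iff at least `p * (2 * m - 1 - n)` brushes are placed
on it.

Max always plays on a dirty vertex with the fewest placed brushes. Whatever order of firings Min
aims at, this keeps the cost of that order (`orderCost`) above a quantity which satisfies a
recursion in the number `q` of vertices that are dirty at the end. Solving the recursion, the game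
lasts at least about `2 * p * q ^ 2 * log (n / q)` turns, which for `q = exp (-1 / 2) * n` is
`p * n ^ 2 / e`.

Min always plays on a fixed vertex whose deficit is at most the average, until some vertex fires.
If `m` vertices are dirty and their total deficit is `d`, then the number of turns that remain is
approximately `p * m ^ 2 * F (d / (p * m ^ 2))`, where `F` solves the differential equation
`F z + F' z = z` obtained by letting all deficits be equal; thus `F z = exp (-z) - 1 + z`. At the
start `d` is about `p * n ^ 2`, and `F 1 = 1 / e`.
-/

namespace BrushPosition

open Finset

/-! ### The cost of firing orders -/

section FiringOrders

variable {V : Type*}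

/-- `σ` lists the vertices of `D` in an order in which Min might make them fire: `v` is to fire when
`σ v` vertices are dirty, so the vertex that fires last has number `1`. -/
def IsFiringOrder (σ : V → ℕ) (D : Finset V) : Prop := Set.BijOn σ D (Set.Icc 1 #D)

/-- The contribution to `orderCost` of a vertex with number `j` and `x` placed brushes. -/
noncomputable def orderTerm (t : ℕ → ℝ) (q j : ℕ) (x : ℝ) : ℝ :=
  if j ≤ q then x else max (t j - x) 0

/-- If each vertex `v ∈ D` has `x v` placed brushes and needs `t j` to fire when `j` vertices
are dirty, then `orderCost t q σ D x` is the number of brushes on the last `q` vertices in the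
order `σ`, plus the number of brushes missing to make all the others fire. -/
noncomputable def orderCost (t : ℕ → ℝ) (q : ℕ) (σ : V → ℕ) (D : Finset V) (x : V → ℝ) : ℝ :=
  ∑ v ∈ D, orderTerm t q (σ v) (x v)

/-- The lower bound for `orderCost` that Max can maintain: the solution of
`(q + 2) * b q = q * (b (q + 1) + t (q + 1) - 2)` with `b n = 0`. -/
noncomputable def orderBound (t : ℕ → ℝ) (n q : ℕ) : ℝ :=
  q * (q + 1) * ∑ l ∈ Ioc q n, (t l - 2) / (l * (l + 1))

/-- Every firing order of `D` costs at least `orderBound`, up to an error `c`. -/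
def OrdersCostly (t : ℕ → ℝ) (n : ℕ) (c : ℝ) (D : Finset V) (x : V → ℝ) : Prop :=
  ∀ σ, IsFiringOrder σ D → ∀ q ≤ #D, orderBound t n q - c ≤ orderCost t q σ D x

variable {t : ℕ → ℝ} {n q : ℕ} {c : ℝ} {σ : V → ℕ} {D : Finset V} {x : V → ℝ} {a v w : V}

theorem orderBound_self (t : ℕ → ℝ) (n : ℕ) : orderBound t n n = 0 := by simp [orderBound]

theorem orderBound_succ (h : q < n) :
    (q + 2) * orderBound t n q = q * (orderBound t n (q + 1) + t (q + 1) - 2) := by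
  have hsum := sum_Ioc_consecutive (fun l : ℕ ↦ (t l - 2) / ((l : ℝ) * (l + 1))) q.le_succ h
  rw [Nat.Ioc_succ_singleton, sum_singleton] at hsum
  unfold orderBound
  rw [← hsum]
  push_cast
  have : (q : ℝ) + 1 + 1 ≠ 0 := by positivity
  field_simp
  ring

namespace IsFiringOrder

theorem update_of_erase [DecidableEq V] (hv : v ∈ D) (hσ : IsFiringOrder σ (D.erase v)) :
    IsFiringOrder (Function.update σ v #D) D := by
  have hagree : Set.EqOn σ (Function.update σ v #D) (D.erase v : Finset V) := fun w hw ↦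
    (Function.update_of_ne (ne_of_mem_erase hw) _ _).symm
  have hcard : #(D.erase v) + 1 = #D := card_erase_add_one hv
  have h := (Set.BijOn.congr hσ hagree).insert (a := v) (by simp [← hcard])
  rw [← coe_insert, insert_erase hv, Function.update_self] at h
  unfold IsFiringOrder
  convert h using 1
  ext j
  simp only [Set.mem_Icc, Set.mem_insert_iff]
  omega

theorem exists_isFiringOrder (D : Finset V) : ∃ σ, IsFiringOrder σ D := by
  classical
  induction D using Finset.induction_on with
  | empty => exact ⟨0, by simp [IsFiringOrder]⟩
  | insert a D ha ih =>
    obtain ⟨σ, hσ⟩ := ih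
    exact ⟨_, update_of_erase (σ := σ) (mem_insert_self a D) (by rwa [erase_insert ha])⟩

theorem exists_apply_eq_succ (hσ : IsFiringOrder σ D) (hq : q < #D) : ∃ a ∈ D, σ a = q + 1 :=
  hσ.surjOn ⟨by omega, by omega⟩

theorem comp_swap [DecidableEq V] (hσ : IsFiringOrder σ D) (ha : a ∈ D) (hw : w ∈ D) :
    IsFiringOrder (σ ∘ Equiv.swap a w) D := by
  refine Set.BijOn.comp hσ ?_
  have hmaps : Set.MapsTo (Equiv.swap a w) (D : Set V) D := by
    intro v hv
    rw [Equiv.swap_apply_def]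
    split_ifs
    exacts [hw, ha, hv]
  exact ⟨hmaps, (Equiv.injective _).injOn, fun v hv ↦ ⟨_, hmaps hv, Equiv.swap_apply_self a w v⟩⟩

theorem card_filter_le (hσ : IsFiringOrder σ D) (hq : q ≤ #D) : #{v ∈ D | σ v ≤ q} = q := by
  have himage : image σ {v ∈ D | σ v ≤ q} = Icc 1 q := by
    have hD : image σ D = Icc 1 #D := by
      rw [← coe_inj, coe_image, coe_Icc]
      exact hσ.image_eq
    rw [show image σ {v ∈ D | σ v ≤ q} = {j ∈ image σ D | j ≤ q} from
      (filter_image (p := (· ≤ q))).symm, hD]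
    ext j
    simp only [mem_filter, mem_Icc]
    omega
  rw [← card_image_of_injOn (hσ.injOn.mono fun _ hv ↦ (mem_filter.mp hv).1), himage, Nat.card_Icc,
    Nat.add_sub_cancel]

end IsFiringOrder

theorem orderCost_card (hσ : IsFiringOrder σ D) : orderCost t #D σ D x = ∑ v ∈ D, x v :=
  sum_congr rfl fun _ hv ↦ if_pos (hσ.mapsTo hv).2

theorem mul_le_orderCost (hσ : IsFiringOrder σ D) (hq : q ≤ #D) {L : ℝ} (hL : ∀ v ∈ D, L ≤ x v) :
    q * L ≤ orderCost t q σ D x :=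
  calc q * L = ∑ v ∈ D with σ v ≤ q, L := by
        rw [sum_const, hσ.card_filter_le hq, nsmul_eq_mul]
    _ = ∑ v ∈ D, if σ v ≤ q then L else 0 := sum_filter _ _
    _ ≤ orderCost t q σ D x := by
        refine sum_le_sum fun v hv ↦ ?_
        unfold orderTerm
        split_ifs
        exacts [hL v hv, le_max_right _ _]

theorem orderCost_eq_succ (hσ : IsFiringOrder σ D) (ha : a ∈ D) (haq : σ a = q + 1) :
    orderCost t q σ D x = orderCost t (q + 1) σ D x - x a + max (t (q + 1) - x a) 0 := by
  classical
  have hrest : ∑ v ∈ D.erase a, orderTerm t q (σ v) (x v) =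
      ∑ v ∈ D.erase a, orderTerm t (q + 1) (σ v) (x v) := by
    refine sum_congr rfl fun v hv ↦ ?_
    have hne : σ v ≠ q + 1 := haq ▸ hσ.injOn.ne (mem_of_mem_erase hv) ha (ne_of_mem_erase hv)
    simp only [orderTerm, show σ v ≤ q ↔ σ v ≤ q + 1 by omega]
  unfold orderCost
  rw [← sum_erase_add _ _ ha, hrest,
    ← sum_erase_add _ (fun v ↦ orderTerm t (q + 1) (σ v) (x v)) ha]
  simp [orderTerm, haq]

theorem orderBound_le_of_succ (hσ : IsFiringOrder σ D) (hqn : q < n) (ha : a ∈ D)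
    (haq : σ a = q + 1) {L : ℝ} (hL : ∀ v ∈ D, L ≤ x v) (hxa : x a ≤ L + 1)
    (h : orderBound t n (q + 1) ≤ orderCost t (q + 1) σ D x) :
    orderBound t n q ≤ orderCost t q σ D x := by
  have hq : q ≤ #D := by
    have := (hσ.mapsTo ha).2
    omega
  have hlast : q * L ≤ orderCost t q σ D x := mul_le_orderCost hσ hq hL
  have hstep : orderBound t n (q + 1) + t (q + 1) - 2 ≤ orderCost t q σ D x + 2 * L := by
    linarith [orderCost_eq_succ (t := t) (x := x) hσ ha haq, le_max_left (t (q + 1) - x a) 0]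
  have hmul := mul_le_mul_of_nonneg_left hstep q.cast_nonneg
  have : (q + 2) * orderBound t n q ≤ (q + 2) * orderCost t q σ D x := by
    linarith [orderBound_succ (t := t) hqn]
  exact le_of_mul_le_mul_left this (by positivity)

theorem max_sub_add_max_sub_le {r s y z : ℝ} (hrs : r ≤ s) (hyz : y ≤ z) :
    max (s - z) 0 + max (r - y) 0 ≤ max (s - y) 0 + max (r - z) 0 := by
  grind

theorem orderCost_comp_swap_le [DecidableEq V] (ht : Monotone t) (ha : a ∈ D) (hw : w ∈ D)
    (hx : x w ≤ x a) (hqa : q < σ a) (haw : σ a ≤ σ w) :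
    orderCost t q (σ ∘ Equiv.swap a w) D x ≤ orderCost t q σ D x := by
  rcases eq_or_ne a w with rfl | hne
  · simp
  have hw' : w ∈ D.erase a := mem_erase.mpr ⟨hne.symm, hw⟩
  have hrest : ∑ v ∈ (D.erase a).erase w, orderTerm t q ((σ ∘ Equiv.swap a w) v) (x v) =
      ∑ v ∈ (D.erase a).erase w, orderTerm t q (σ v) (x v) := by
    refine sum_congr rfl fun v hv ↦ ?_
    rw [mem_erase, mem_erase] at hv
    rw [Function.comp_apply, Equiv.swap_apply_of_ne_of_ne hv.2.1 hv.1]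
  unfold orderCost
  rw [← sum_erase_add _ _ ha, ← sum_erase_add _ _ hw', hrest,
    ← sum_erase_add _ (fun v ↦ orderTerm t q (σ v) (x v)) ha,
    ← sum_erase_add _ (fun v ↦ orderTerm t q (σ v) (x v)) hw']
  simp only [Function.comp_apply, Equiv.swap_apply_left, Equiv.swap_apply_right, orderTerm,
    if_neg hqa.not_ge, if_neg (hqa.trans_le haw).not_ge]
  linarith [max_sub_add_max_sub_le (ht haw) hx]

theorem orderCost_sub_one_le_add_single [DecidableEq V] (t : ℕ → ℝ) (q : ℕ) (σ : V → ℕ)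
    (D : Finset V) (x : V → ℝ) (w : V) :
    orderCost t q σ D x - 1 ≤ orderCost t q σ D (x + Pi.single w 1) := by
  have hterm : ∀ v ∈ D, orderTerm t q (σ v) (x v) ≤
      orderTerm t q (σ v) ((x + Pi.single w 1 : V → ℝ) v) + if v = w then 1 else 0 := by
    intro v _
    rw [Pi.add_apply, Pi.single_apply]
    unfold orderTerm
    grind
  have h := sum_le_sum hterm
  rw [sum_add_distrib, sum_ite_eq'] at h
  have : (if w ∈ D then (1 : ℝ) else 0) ≤ 1 := by split_ifs <;> norm_num
  unfold orderCost
  linarith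

theorem orderCost_add_single [DecidableEq V] (hw : w ∈ D) (hwq : σ w ≤ q) :
    orderCost t q σ D (x + Pi.single w 1) = orderCost t q σ D x + 1 := by
  have hterm : ∀ v ∈ D, orderTerm t q (σ v) ((x + Pi.single w 1 : V → ℝ) v) =
      orderTerm t q (σ v) (x v) + if v = w then 1 else 0 := by
    intro v _
    rw [Pi.add_apply, Pi.single_apply]
    split_ifs with h
    · simp only [h, orderTerm, if_pos hwq]
    · simp only [add_zero]
  rw [orderCost, sum_congr rfl hterm, sum_add_distrib, sum_ite_eq', if_pos hw, orderCost]

namespace OrdersCostly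

theorem of_zero (t : ℕ → ℝ) (D : Finset V) : OrdersCostly t #D 0 D 0 := by
  intro σ hσ q hq
  rw [sub_zero]
  induction hq using Nat.decreasingInduction with
  | self => simp [orderCost_card hσ, orderBound_self]
  | of_succ q hq ih =>
    obtain ⟨a, ha, haq⟩ := hσ.exists_apply_eq_succ hq
    exact orderBound_le_of_succ hσ hq ha haq (L := 0) (fun _ _ ↦ le_rfl) (by simp) ih

theorem add_single [DecidableEq V] (h : OrdersCostly t n c D x) (w : V) :
    OrdersCostly t n (c + 1) D (x + Pi.single w 1) := by
  intro σ hσ q hq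
  linarith [h σ hσ q hq, orderCost_sub_one_le_add_single t q σ D x w]

theorem add_single_of_forall_le [DecidableEq V] (ht : Monotone t) (hn : #D ≤ n)
    (h : OrdersCostly t n 1 D x) (hw : w ∈ D) (hmin : ∀ v ∈ D, x w ≤ x v) :
    OrdersCostly t n 0 D (x + Pi.single w 1) := by
  have hL : ∀ v ∈ D, x w ≤ (x + Pi.single w 1 : V → ℝ) v := fun v hv ↦
    (hmin v hv).trans (le_add_of_nonneg_right (by rw [Pi.single_apply]; split_ifs <;> norm_num))
  have hxw : (x + Pi.single w 1 : V → ℝ) w = x w + 1 := by simp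
  intro σ hσ q hq
  rw [sub_zero]
  have of_last : ∀ σ, IsFiringOrder σ D → ∀ q ≤ #D, σ w ≤ q →
      orderBound t n q ≤ orderCost t q σ D (x + Pi.single w 1) := fun σ hσ q hq hwq ↦ by
    linarith [h σ hσ q hq, orderCost_add_single (t := t) (x := x) hw hwq]
  induction hq using Nat.decreasingInduction generalizing σ with
  | self => exact of_last σ hσ _ le_rfl (hσ.mapsTo hw).2
  | of_succ q hq ih =>
    by_cases hwq : σ w ≤ q
    · exact of_last σ hσ q hq.le hwq
    obtain ⟨a, ha, haq⟩ := hσ.exists_apply_eq_succ hq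
    rcases le_total ((x + Pi.single w 1 : V → ℝ) a) (x w + 1) with hxa | hxa
    · exact orderBound_le_of_succ hσ (by omega) ha haq hL hxa (ih σ hσ)
    · have hσ' := hσ.comp_swap ha hw
      -- Making `a`, which has more brushes, fire before `w` is cheaper.
      calc orderBound t n q ≤ orderCost t q (σ ∘ Equiv.swap a w) D (x + Pi.single w 1) :=
            orderBound_le_of_succ hσ' (by omega) hw (by simp [haq]) hL hxw.le (ih _ hσ')
        _ ≤ orderCost t q σ D (x + Pi.single w 1) :=
            orderCost_comp_swap_le ht ha hw (hxw ▸ hxa) (by omega) (by omega)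

theorem erase [DecidableEq V] (h : OrdersCostly t n c D x) (hv : v ∈ D) (htv : t #D ≤ x v) :
    OrdersCostly t n c (D.erase v) x := by
  intro σ hσ q hq
  have hcard : #(D.erase v) + 1 = #D := card_erase_add_one hv
  refine (h _ (hσ.update_of_erase hv) q (by omega)).trans_eq ?_
  have hterm : orderTerm t q (Function.update σ v #D v) (x v) = 0 := by
    rw [Function.update_self, orderTerm, if_neg (by omega), max_eq_right (sub_nonpos.mpr htv)]
  rw [orderCost, ← sum_erase_add _ _ hv, hterm, add_zero]
  exact sum_congr rfl fun w hw ↦ by rw [Function.update_of_ne (ne_of_mem_erase hw)]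

theorem congr {y : V → ℝ} (h : OrdersCostly t n c D x) (hxy : ∀ v ∈ D, x v = y v) :
    OrdersCostly t n c D y := fun σ hσ q hq ↦
  (h σ hσ q hq).trans_eq (sum_congr rfl fun v hv ↦ by rw [hxy v hv])

theorem orderBound_sub_le_sum (h : OrdersCostly t n c D x) :
    orderBound t n #D - c ≤ ∑ v ∈ D, x v := by
  obtain ⟨σ, hσ⟩ := IsFiringOrder.exists_isFiringOrder D
  exact orderCost_card (t := t) (x := x) hσ ▸ h σ hσ _ le_rfl

end OrdersCostly

end FiringOrders

/-! ### Complete graphs -/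

section CompleteGraph

variable {V : Type*}

/-- The number of brushes a dirty vertex of a complete graph on `n` vertices must have received
from the players in order to be ready when `m` vertices are dirty: of the `p * (m - 1)` brushes it
needs, `p * (n - m)` have come from the clean vertices. -/
def threshold (p : ℝ) (n m : ℕ) : ℝ := p * (2 * m - 1 - n)

/-- The number of brushes that the players have put on a dirty vertex of a complete graph, that is,
those which it has not received from the clean vertices. -/
def placed [Fintype V] (p : ℝ) (s : BrushPosition V) (v : V) : ℝ :=
  s.brushes v - p * (Fintype.card V - #s.dirty)

/-- The number of brushes that a dirty vertex of a complete graph lacks to be ready. -/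
def deficit (p : ℝ) (s : BrushPosition V) (v : V) : ℝ := p * (#s.dirty - 1) - s.brushes v

theorem placed_add_deficit [Fintype V] (p : ℝ) (s : BrushPosition V) (v : V) :
    s.placed p v + s.deficit p v = threshold p (Fintype.card V) #s.dirty := by
  unfold placed deficit threshold
  ring

theorem threshold_monotone {p : ℝ} (hp : 0 ≤ p) (n : ℕ) : Monotone (threshold p n) := by
  intro i j hij
  unfold threshold
  gcongr

/-- The position of the game before any brush is placed and any vertex fires. -/
def initial (V : Type*) [Fintype V] : BrushPosition V where
  dirty := univ
  brushes := 0

theorem dirty_initial [Fintype V] : (initial V).dirty = univ := rfl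

theorem placed_initial [Fintype V] (p : ℝ) : (initial V).placed p = 0 := by
  ext v
  simp [placed, initial]

variable [DecidableEq V] {p : ℝ} {s : BrushPosition V} {u v w : V}

theorem stabilize_induction {G : SimpleGraph V} [DecidableRel G.Adj]
    {C : BrushPosition V → Prop} (hfire : ∀ s v, C s → s.Ready p G v → C (s.fire p G v))
    (s : BrushPosition V) (hs : C s) : C (s.stabilize p G) := by
  induction hn : #s.dirty using Nat.strong_induction_on generalizing s with
  | _ n ih =>
    subst hn
    rw [stabilize]
    split_ifs with h
    · exact ih _ (card_erase_lt_of_mem h.choose_spec.1) _ (hfire _ _ hs h.choose_spec) rfl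
    · exact hs

theorem start_eq_stabilize_initial [Fintype V] (p : ℝ) (G : SimpleGraph V) [DecidableRel G.Adj] :
    start p G = (initial V).stabilize p G :=
  rfl

theorem dirty_place (s : BrushPosition V) (v : V) : (s.place v).dirty = s.dirty := rfl

theorem placed_place [Fintype V] (p : ℝ) (s : BrushPosition V) (v : V) :
    (s.place v).placed p = s.placed p + Pi.single v 1 := by
  ext w
  simp only [placed, place, Pi.add_apply, Pi.single_apply]
  split_ifs <;> ring

theorem deficit_place_self (p : ℝ) (s : BrushPosition V) (v : V) :
    (s.place v).deficit p v = s.deficit p v - 1 := by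
  simp only [deficit, place, if_true]
  ring

theorem deficit_place_of_ne (p : ℝ) (s : BrushPosition V) (h : w ≠ v) :
    (s.place v).deficit p w = s.deficit p w := by
  simp only [deficit, place, if_neg h]

theorem dirtyNeighbors_top (s : BrushPosition V) (v : V) :
    s.dirtyNeighbors ⊤ v = s.dirty.erase v := by
  ext w
  simp [dirtyNeighbors, and_comm, eq_comm]

theorem ready_top_iff : s.Ready p ⊤ v ↔ v ∈ s.dirty ∧ s.deficit p v ≤ 0 := by
  refine and_congr_right fun hv ↦ ?_
  rw [dirtyNeighbors_top, cast_card_erase_of_mem hv, deficit, sub_nonpos]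

theorem threshold_le_placed_of_ready [Fintype V] (h : s.Ready p ⊤ v) :
    threshold p (Fintype.card V) #s.dirty ≤ s.placed p v := by
  linarith [placed_add_deficit p s v, (ready_top_iff.mp h).2]

theorem card_dirty_fire_add_one {G : SimpleGraph V} [DecidableRel G.Adj] (hv : v ∈ s.dirty) :
    #(s.fire p G v).dirty + 1 = #s.dirty :=
  card_erase_add_one hv

theorem deficit_fire_top (hv : v ∈ s.dirty) (hw : w ∈ s.dirty.erase v) :
    (s.fire p ⊤ v).deficit p w = s.deficit p w - 2 * p := by
  simp only [deficit, fire, dirtyNeighbors_top, if_neg (ne_of_mem_erase hw), if_pos hw,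
    cast_card_erase_of_mem hv]
  ring

theorem placed_fire_top [Fintype V] (hv : v ∈ s.dirty) (hw : w ∈ s.dirty.erase v) :
    (s.fire p ⊤ v).placed p w = s.placed p w := by
  simp only [placed, fire, dirtyNeighbors_top, if_neg (ne_of_mem_erase hw), if_pos hw,
    cast_card_erase_of_mem hv]
  ring

end CompleteGraph

/-! ### Max's strategy -/

section MaxStrategy

variable {V : Type*} [Fintype V] [DecidableEq V] {p : ℝ} {s : BrushPosition V} {v w : V}
  {q k : ℕ} {b c : ℝ}

/-- The number of brushes that are already placed on the dirty vertices, minus the number of those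
that will be used up by the time only `q` vertices are dirty. It grows by `1` with every turn, and
firings can only lower it as long as more than `q` vertices are dirty. -/
def remainder (p : ℝ) (q : ℕ) (s : BrushPosition V) : ℝ :=
  ∑ v ∈ s.dirty, s.placed p v - ∑ l ∈ Ioc q #s.dirty, threshold p (Fintype.card V) l

theorem remainder_place (p : ℝ) (q : ℕ) (hv : v ∈ s.dirty) :
    remainder p q (s.place v) = remainder p q s + 1 := by
  simp only [remainder, placed_place, Pi.add_apply, sum_add_distrib]
  simp only [dirty_place, sum_pi_single', if_pos hv]
  ring

theorem remainder_fire_le (hq : q < #s.dirty) (hv : s.Ready p ⊤ v) :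
    remainder p q (s.fire p ⊤ v) ≤ remainder p q s := by
  have hcard : #(s.fire p ⊤ v).dirty + 1 = #s.dirty := card_dirty_fire_add_one hv.1
  have hplaced : ∑ w ∈ (s.fire p ⊤ v).dirty, (s.fire p ⊤ v).placed p w =
      ∑ w ∈ s.dirty, s.placed p w - s.placed p v := by
    rw [← sum_erase_add _ _ hv.1, add_sub_cancel_right]
    exact sum_congr rfl fun w hw ↦ placed_fire_top hv.1 hw
  have hthreshold :=
    sum_Ioc_succ_top (Nat.le_of_lt_succ (hcard ▸ hq)) (threshold p (Fintype.card V))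
  rw [hcard] at hthreshold
  unfold remainder
  linarith [threshold_le_placed_of_ready hv]

/-- The invariant of Max's strategy: every firing order is costly, up to an error `c` (which is `1`
after a turn of Min and `0` after a turn of Max), and too few brushes have been played for fewer
than `q` vertices to be dirty. -/
structure MaxHolds (p : ℝ) (q : ℕ) (c b : ℝ) (s : BrushPosition V) : Prop where
  le_card : q ≤ #s.dirty
  ordersCostly : OrdersCostly (threshold p (Fintype.card V)) (Fintype.card V) c s.dirty (s.placed p)
  remainder_lt : remainder p q s < b

namespace MaxHolds

theorem fire (h : MaxHolds p q c b s) (hb : b ≤ orderBound (threshold p (Fintype.card V))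
    (Fintype.card V) q - c) (hv : s.Ready p ⊤ v) : MaxHolds p q c b (s.fire p ⊤ v) := by
  have hq : q < #s.dirty := by
    refine h.le_card.lt_of_ne fun hq ↦ ?_
    subst hq
    have hlt := h.remainder_lt
    rw [remainder, Ioc_self, sum_empty, sub_zero] at hlt
    linarith [h.ordersCostly.orderBound_sub_le_sum]
  have hcard : #(s.fire p ⊤ v).dirty + 1 = #s.dirty := card_dirty_fire_add_one hv.1
  refine ⟨by omega, ?_, (remainder_fire_le hq hv).trans_lt h.remainder_lt⟩
  exact (h.ordersCostly.erase hv.1 (threshold_le_placed_of_ready hv)).congr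
    fun w hw ↦ (placed_fire_top hv.1 hw).symm

theorem stabilize (h : MaxHolds p q c b s) (hb : b ≤ orderBound (threshold p (Fintype.card V))
    (Fintype.card V) q - c) : MaxHolds p q c b (s.stabilize p ⊤) :=
  stabilize_induction (fun _ _ h hv ↦ h.fire hb hv) s h

theorem place_min (h : MaxHolds p q c b s) (hv : v ∈ s.dirty) :
    MaxHolds p q (c + 1) (b + 1) (s.place v) where
  le_card := h.le_card
  ordersCostly := placed_place p s v ▸ h.ordersCostly.add_single v
  remainder_lt := by linarith [remainder_place p q hv, h.remainder_lt]

theorem place_max (hp : 0 ≤ p) (h : MaxHolds p q 1 b s) (hw : w ∈ s.dirty)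
    (hmin : ∀ v ∈ s.dirty, s.placed p w ≤ s.placed p v) :
    MaxHolds p q 0 (b + 1) (s.place w) where
  le_card := h.le_card
  ordersCostly := placed_place p s w ▸
    h.ordersCostly.add_single_of_forall_le (threshold_monotone hp _) (card_le_univ _) hw hmin
  remainder_lt := by linarith [remainder_place p q hw, h.remainder_lt]

theorem not_minForces (hp : 0 ≤ p) (hq : 1 ≤ q) (k : ℕ) : ∀ s : BrushPosition V,
    (MaxHolds p q 0 (orderBound (threshold p (Fintype.card V)) (Fintype.card V) q - 1 - k) s →
      ¬ MinForces p ⊤ k .min (s.stabilize p ⊤)) ∧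
    (MaxHolds p q 1 (orderBound (threshold p (Fintype.card V)) (Fintype.card V) q - 1 - k) s →
      ¬ MinForces p ⊤ k .max (s.stabilize p ⊤)) := by
  have nonempty : ∀ {c b : ℝ} {s : BrushPosition V}, MaxHolds p q c b s → s.dirty.Nonempty :=
    fun h ↦ card_pos.mp (hq.trans h.le_card)
  induction k with
  | zero =>
    intro s
    constructor <;> exact fun h ↦ (nonempty (h.stabilize (by simp))).ne_empty
  | succ k ih =>
    have := k.cast_nonneg (α := ℝ)
    push_cast
    intro s
    constructor
    · intro h
      have h' := h.stabilize (by linarith)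
      rintro (hempty | ⟨v, hv, hforces⟩)
      · exact (nonempty h').ne_empty hempty
      · refine (ih _).2 ?_ hforces
        convert h'.place_min hv using 1 <;> ring
    · intro h
      have h' := h.stabilize (by linarith)
      rintro (hempty | hforces)
      · exact (nonempty h').ne_empty hempty
      · obtain ⟨w, hw, hmin⟩ := exists_min_image _ ((s.stabilize p ⊤).placed p) (nonempty h')
        refine (ih _).1 ?_ (hforces w hw)
        convert h'.place_max hp hw hmin using 1
        ring

end MaxHolds

theorem sum_threshold (p : ℝ) {q n : ℕ} (h : q ≤ n) :
    ∑ l ∈ Ioc q n, threshold p n l = p * q * (n - q) := by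
  have hsum : ∀ m, q ≤ m → ∑ l ∈ Ioc q m, threshold p n l = p * (m - q) * (m + q - n) := by
    intro m hm
    induction m, hm using Nat.le_induction with
    | base => simp
    | succ m hm ih =>
      rw [sum_Ioc_succ_top hm, ih, threshold]
      push_cast
      ring
  rw [hsum n h]
  ring

theorem orderBound_add_le_of_minForces (hp : 0 ≤ p) (hq : 1 ≤ q) (hqn : q ≤ Fintype.card V)
    (hk : MinForces p (⊤ : SimpleGraph V) k .min (start p ⊤)) :
    orderBound (threshold p (Fintype.card V)) (Fintype.card V) q + p * q * (Fintype.card V - q) - 1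
      ≤ k := by
  rw [start_eq_stabilize_initial] at hk
  contrapose! hk
  refine (MaxHolds.not_minForces hp hq k _).1 ⟨hqn, ?_, ?_⟩
  · rw [placed_initial]
    exact OrdersCostly.of_zero _ _
  · simp only [remainder, placed_initial, dirty_initial, card_univ, sum_threshold p hqn,
      Pi.zero_apply, sum_const_zero]
    linarith

theorem sum_Ioc_inv_mul_succ {q n : ℕ} (h : q ≤ n) :
    ∑ l ∈ Ioc q n, 1 / ((l : ℝ) * (l + 1)) = 1 / (q + 1) - 1 / (n + 1) := by
  induction n, h using Nat.le_induction with
  | base => simp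
  | succ n hn ih =>
    rw [sum_Ioc_succ_top hn, ih]
    push_cast
    field_simp
    ring

theorem log_div_le_sum_Ioc_inv {q n : ℕ} (h : q ≤ n) :
    Real.log ((n + 2) / (q + 2)) ≤ ∑ l ∈ Ioc q n, 1 / ((l : ℝ) + 1) := by
  induction n, h using Nat.le_induction with
  | base => simp [div_self (by positivity : (q : ℝ) + 2 ≠ 0)]
  | succ n hn ih =>
    rw [sum_Ioc_succ_top hn]
    have hratio : ((n + 1 : ℕ) + 2 : ℝ) / (q + 2) = (n + 2) / (q + 2) * ((n + 3) / (n + 2)) := by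
      push_cast
      field_simp
      ring
    have hlog : Real.log (((n : ℝ) + 3) / (n + 2)) ≤ 1 / ((n + 1 : ℕ) + 1) := by
      refine (Real.log_le_sub_one_of_pos (by positivity)).trans_eq ?_
      push_cast
      field_simp
      ring
    rw [hratio, Real.log_mul (by positivity) (by positivity)]
    linarith

theorem orderBound_threshold (p : ℝ) {q n : ℕ} (h : q ≤ n) :
    orderBound (threshold p n) n q = 2 * p * q * (q + 1) * ∑ l ∈ Ioc q n, 1 / ((l : ℝ) + 1) -
      (p * (n + 1) + 2) * q * (n - q) / (n + 1) := by
  have hterm : ∀ l ∈ Ioc q n, (threshold p n l - 2) / (l * (l + 1)) =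
      2 * p * (1 / ((l : ℝ) + 1)) - (p * (n + 1) + 2) * (1 / ((l : ℝ) * (l + 1))) := by
    intro l hl
    have : (0 : ℝ) < l := by exact_mod_cast (mem_Ioc.mp hl).1.pos
    unfold threshold
    field_simp
    ring
  rw [orderBound, sum_congr rfl hterm, sum_sub_distrib, ← mul_sum, ← mul_sum,
    sum_Ioc_inv_mul_succ h]
  field_simp
  ring

theorem le_fractionalGameBrushNumber_top (hp : 0 ≤ p) (hq : 1 ≤ q)
    (hqn : q ≤ Fintype.card V) :
    2 * p * q * (q + 1) * Real.log ((Fintype.card V + 2) / (q + 2)) - 2 * Fintype.card V - 1 ≤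
      fractionalGameBrushNumber p (⊤ : SimpleGraph V) := by
  have hforces : MinForces p (⊤ : SimpleGraph V) (fractionalGameBrushNumber p ⊤) .min (start p ⊤) :=
    Nat.sInf_mem (exists_minForces_start p hp ⊤)
  have hbound := orderBound_add_le_of_minForces hp hq hqn hforces
  rw [orderBound_threshold p hqn] at hbound
  set n := Fintype.card V
  have hlog := mul_le_mul_of_nonneg_left (log_div_le_sum_Ioc_inv hqn)
    (by positivity : 0 ≤ 2 * p * q * (q + 1))
  have herror : (p * (n + 1) + 2) * q * (n - q) / (n + 1) ≤ p * q * (n - q) + 2 * n := by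
    have hqn' : (q : ℝ) ≤ n := by exact_mod_cast hqn
    rw [div_le_iff₀ (by positivity)]
    nlinarith [mul_nonneg (q.cast_nonneg (α := ℝ)) (q.cast_nonneg (α := ℝ))]
  linarith

end MaxStrategy

/-! ### The value of a position -/

/-- The function `z ↦ exp (-z) - 1 + z`, extended by `0` to negative `z`. With time and deficits
measured in units of `p * m ^ 2`, it is the number of turns that remain when `m` vertices are dirty
and their total deficit is `z`. -/
noncomputable def rescaledValue (z : ℝ) : ℝ := Real.exp (-max z 0) - 1 + max z 0

/-- The derivative of `rescaledValue`. -/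
noncomputable def rescaledSlope (z : ℝ) : ℝ := 1 - Real.exp (-max z 0)

theorem rescaledValue_of_nonpos {z : ℝ} (hz : z ≤ 0) : rescaledValue z = 0 := by
  simp [rescaledValue, hz]

theorem rescaledValue_nonneg (z : ℝ) : 0 ≤ rescaledValue z := by
  linarith [rescaledValue.eq_1 z, Real.add_one_le_exp (-max z 0)]

theorem rescaledValue_max_zero (z : ℝ) : rescaledValue (max z 0) = rescaledValue z := by
  simp [rescaledValue]

theorem rescaledValue_one : rescaledValue 1 = Real.exp (-1) := by
  simp [rescaledValue]

theorem rescaledSlope_nonneg (z : ℝ) : 0 ≤ rescaledSlope z :=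
  sub_nonneg.mpr (Real.exp_le_one_iff.mpr (neg_nonpos.mpr (le_max_right z 0)))

theorem rescaledSlope_le_one (z : ℝ) : rescaledSlope z ≤ 1 :=
  sub_le_self _ (Real.exp_pos _).le

theorem rescaledValue_add_rescaledSlope {z : ℝ} (hz : 0 ≤ z) :
    rescaledValue z + rescaledSlope z = z := by
  rw [rescaledValue, rescaledSlope, max_eq_left hz]
  ring

theorem exp_neg_mul_le (a b : ℝ) : Real.exp (-a) * (1 + a - b) ≤ Real.exp (-b) := by
  rw [show -b = -a + (a - b) by ring, Real.exp_add]
  gcongr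
  linarith [Real.add_one_le_exp (a - b)]

theorem rescaledValue_tangent_le (z y : ℝ) :
    rescaledValue z + (y - z) * rescaledSlope z ≤ rescaledValue y := by
  have hmax : (y - z) * rescaledSlope z ≤ (max y 0 - max z 0) * rescaledSlope z := by
    rcases le_total z 0 with hz | hz
    · simp [rescaledSlope, hz]
    · rw [max_eq_left hz]
      gcongr
      exacts [rescaledSlope_nonneg z, le_max_left y 0]
  have := exp_neg_mul_le (max z 0) (max y 0)
  unfold rescaledValue rescaledSlope at *
  linarith

theorem rescaledValue_monotone : Monotone rescaledValue := fun z y hzy ↦ by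
  nlinarith [rescaledValue_tangent_le z y, rescaledSlope_nonneg z]

theorem rescaledValue_le_add_sub {z y : ℝ} (hzy : z ≤ y) :
    rescaledValue y ≤ rescaledValue z + (y - z) := by
  nlinarith [rescaledValue_tangent_le y z, rescaledSlope_le_one y]

theorem rescaledSlope_le_add_sub {z y : ℝ} (hzy : z ≤ y) :
    rescaledSlope y ≤ rescaledSlope z + (y - z) := by
  have hle : max z 0 ≤ max y 0 := by gcongr
  have hsub : max y 0 - max z 0 ≤ y - z := by grind
  have hexp := exp_neg_mul_le (max z 0) (max y 0)
  have hone : Real.exp (-max z 0) ≤ 1 := sub_nonneg.mp (rescaledSlope_nonneg z)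
  unfold rescaledSlope
  nlinarith

theorem rescaledValue_sub_le (z : ℝ) {δ : ℝ} (hδ : 0 ≤ δ) :
    rescaledValue (z - δ) ≤ rescaledValue z - δ * rescaledSlope z + δ ^ 2 := by
  have htangent := rescaledValue_tangent_le (z - δ) z
  have hslope := rescaledSlope_le_add_sub (sub_le_self z hδ)
  nlinarith

/-- An approximation to the number of turns that remain when `m` vertices are dirty, with total
deficit `d`. -/
noncomputable def value (p : ℝ) (m : ℕ) (d : ℝ) : ℝ := p * m ^ 2 * rescaledValue (d / (p * m ^ 2))

/-- An approximation to the number of turns that remain when `a + 1` vertices are dirty, with total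
deficit `d`, and Min spends all turns until the next firing on a vertex with deficit `y`: it fires
after `2 * y` turns, and each of the other `a` vertices then gets `p` brushes and needs `p` less. -/
noncomputable def targetValue (p : ℝ) (a : ℕ) (d y : ℝ) : ℝ :=
  2 * y + value p a (d - 2 * y - 2 * p * a)

section Value

variable {p : ℝ} {m a : ℕ} {d d' y e : ℝ}

theorem value_nonneg (hp : 0 < p) (m : ℕ) (d : ℝ) : 0 ≤ value p m d :=
  mul_nonneg (by positivity) (rescaledValue_nonneg _)

theorem value_of_nonpos (hp : 0 < p) (m : ℕ) (hd : d ≤ 0) : value p m d = 0 := by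
  rw [value, rescaledValue_of_nonpos (div_nonpos_of_nonpos_of_nonneg hd (by positivity)), mul_zero]

theorem value_monotone (hp : 0 < p) (m : ℕ) : Monotone (value p m) := fun d d' h ↦ by
  unfold value
  gcongr
  apply rescaledValue_monotone
  gcongr

theorem value_le_add_sub (hp : 0 < p) (m : ℕ) (h : d ≤ d') :
    value p m d' ≤ value p m d + (d' - d) := by
  rcases m.eq_zero_or_pos with rfl | hm
  · simpa [value] using h
  have hlip := mul_le_mul_of_nonneg_left
    (rescaledValue_le_add_sub (by gcongr : d / (p * m ^ 2) ≤ d' / (p * m ^ 2)))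
    (by positivity : 0 ≤ p * (m : ℝ) ^ 2)
  refine hlip.trans_eq ?_
  unfold value
  field_simp

theorem targetValue_monotone (hp : 0 < p) (a : ℕ) (d : ℝ) : Monotone (targetValue p a d) :=
  fun y y' h ↦ by
    have := value_le_add_sub hp a
      (by linarith : d - 2 * y' - 2 * p * a ≤ d - 2 * y - 2 * p * a)
    unfold targetValue
    linarith

theorem targetValue_le_targetValue (hp : 0 < p) (a : ℕ) (h : d ≤ d') (y : ℝ) :
    targetValue p a d y ≤ targetValue p a d' y := by
  unfold targetValue
  gcongr
  apply value_monotone hp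
  gcongr

theorem value_after_target_le (hp : 0 < p) (a : ℕ) {z : ℝ} (hz : 0 ≤ z) :
    value p a (p * (a + 1) ^ 2 * z - 2 * (p * (a + 1) * z) - 2 * p * a) ≤
      p * a ^ 2 * rescaledValue z - 2 * p * a * rescaledSlope z + 4 * p := by
  rcases a.eq_zero_or_pos with rfl | ha
  · simpa [value] using hp.le
  calc _ ≤ p * a ^ 2 * rescaledValue (z - 2 / a) := by
        unfold value
        gcongr
        apply rescaledValue_monotone
        rw [div_le_iff₀ (by positivity)]
        field_simp
        nlinarith
    _ ≤ p * a ^ 2 * (rescaledValue z - 2 / a * rescaledSlope z + (2 / a) ^ 2) := by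
        gcongr
        exact rescaledValue_sub_le z (by positivity)
    _ = _ := by
        field_simp
        ring

theorem targetValue_le_value_add (hp : 0 < p) (hd : 0 ≤ d) (hda : d ≤ p * (a + 1) ^ 2)
    (hy : y ≤ d / (a + 1)) : targetValue p a d y ≤ value p (a + 1) d + 6 * p := by
  obtain ⟨z, rfl⟩ : ∃ z, d = p * (a + 1) ^ 2 * z := ⟨d / (p * (a + 1) ^ 2), by field_simp⟩
  have hz : 0 ≤ z := nonneg_of_mul_nonneg_right hd (by positivity)
  have hz1 : z ≤ 1 := (mul_le_iff_le_one_right (by positivity)).mp hda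
  have hy' : y ≤ p * (a + 1) * z := hy.trans_eq (by field_simp)
  have hafter := value_after_target_le hp a hz
  have hslope : rescaledSlope z = z - rescaledValue z := by
    linarith [rescaledValue_add_rescaledSlope hz]
  calc targetValue p a (p * (a + 1) ^ 2 * z) y
      ≤ targetValue p a (p * (a + 1) ^ 2 * z) (p * (a + 1) * z) := targetValue_monotone hp a _ hy'
    _ ≤ p * (a + 1) ^ 2 * rescaledValue z - p * rescaledValue z + 2 * p * z + 4 * p := by
        rw [hslope] at hafter
        unfold targetValue
        linarith
    _ ≤ p * (a + 1) ^ 2 * rescaledValue z + 6 * p := by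
        linarith [mul_nonneg hp.le (rescaledValue_nonneg z), mul_le_of_le_one_right hp.le hz1]
    _ = value p (a + 1) (p * (a + 1) ^ 2 * z) + 6 * p := by
        rw [value, Nat.cast_succ, mul_div_cancel_left₀ z (by positivity)]

theorem value_rescale_le (hp : 0 < p) (m : ℕ) (d : ℝ) :
    value p m (d * (m / (m + 1)) ^ 2) ≤ value p (m + 1) d := by
  rcases m.eq_zero_or_pos with rfl | hm
  · simpa [value] using mul_nonneg hp.le (rescaledValue_nonneg _)
  have hrescale : d * (m / (m + 1)) ^ 2 / (p * m ^ 2) = d / (p * (m + 1) ^ 2) := by field_simp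
  unfold value
  rw [hrescale, Nat.cast_succ]
  gcongr
  exacts [rescaledValue_nonneg _, by linarith]

theorem value_le_value_succ_add_one (hp : 0 < p)
    (h : 2 * max d 0 + (m + 1) * e ≤ (m + 1) * (2 * p * m + 1)) :
    value p m (d - 2 * p * m + e) ≤ value p (m + 1) d + 1 := by
  set d₁ := max d 0 * (m / (m + 1)) ^ 2
  have hle : d - 2 * p * m + e ≤ d₁ + 1 := by
    have hdiv : max d 0 * (2 / (m + 1)) + e ≤ 2 * p * m + 1 := by
      field_simp
      linarith
    have hd₁ : d₁ = max d 0 - max d 0 * (2 / (m + 1)) + max d 0 * (1 / (m + 1)) ^ 2 := by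
      simp only [d₁]
      field_simp
      ring
    have : 0 ≤ max d 0 * (1 / (m + 1) : ℝ) ^ 2 := by positivity
    linarith [le_max_left d 0]
  calc value p m (d - 2 * p * m + e)
      ≤ value p m (d₁ + 1) := value_monotone hp m hle
    _ ≤ value p m d₁ + 1 := by
        linarith [value_le_add_sub hp m (by linarith : d₁ ≤ d₁ + 1)]
    _ ≤ value p (m + 1) (max d 0) + 1 := by
        gcongr
        exact value_rescale_le hp m _
    _ = value p (m + 1) d + 1 := by
        have hmax : max d 0 / (p * (m + 1 : ℕ) ^ 2) = max (d / (p * (m + 1 : ℕ) ^ 2)) 0 := by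
          rw [← max_div_div_right (by positivity), zero_div]
        rw [value, hmax, rescaledValue_max_zero, value]

end Value

/-! ### Min's strategy -/

section MinStrategy

variable {V : Type*} {p : ℝ} {s : BrushPosition V} {u v w : V}

/-- The sum of the deficits of the dirty vertices. -/
def totalDeficit (p : ℝ) (s : BrushPosition V) : ℝ := ∑ v ∈ s.dirty, s.deficit p v

/-- The value of a position, plus the `6 * p + 3` turns per dirty vertex that bound the error of the
approximation. -/
noncomputable def potential (p : ℝ) (s : BrushPosition V) : ℝ :=
  value p #s.dirty (totalDeficit p s) + (6 * p + 3) * #s.dirty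

/-- A bound for the number of turns that remain when Min spends all turns until the next firing on
the vertex `v`. -/
noncomputable def turnBound (p : ℝ) (P : Player) (s : BrushPosition V) (v : V) : ℝ :=
  (6 * p + 3) * #s.dirty + match P with
    | .min => targetValue p (#s.dirty - 1) (totalDeficit p s) (s.deficit p v)
    | .max => targetValue p (#s.dirty - 1) (totalDeficit p s - 1) (s.deficit p v) + 1

theorem turnBound_pos (hp : 0 < p) (P : Player) (h : 0 < s.deficit p v) :
    0 < turnBound p P s v := by
  have htarget : ∀ d, 0 < targetValue p (#s.dirty - 1) d (s.deficit p v) := fun d ↦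
    add_pos_of_pos_of_nonneg (by positivity) (value_nonneg hp _ _)
  have hconst : 0 ≤ (6 * p + 3) * #s.dirty := by positivity
  cases P
  · exact add_pos_of_nonneg_of_pos hconst (htarget _)
  · exact add_pos_of_nonneg_of_pos hconst (add_pos (htarget _) one_pos)

theorem turnBound_le_max (hp : 0 < p) (P : Player) (s : BrushPosition V) (v : V) :
    turnBound p P s v ≤ (6 * p + 3) * #s.dirty +
      targetValue p (#s.dirty - 1) (totalDeficit p s) (s.deficit p v) + 1 := by
  cases P
  · exact (lt_add_one _).le
  · have := targetValue_le_targetValue hp (#s.dirty - 1)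
      (sub_le_self (totalDeficit p s) zero_le_one) (s.deficit p v)
    simp only [turnBound]
    linarith

/-- No dirty vertex has received more brushes from the players than it can need, up to one. -/
def PlacedBounded [Fintype V] (p : ℝ) (s : BrushPosition V) : Prop :=
  ∀ v ∈ s.dirty, 0 ≤ s.placed p v ∧ s.placed p v ≤ p * (Fintype.card V - 1) + 1

theorem PlacedBounded.deficit_le [Fintype V] (h : PlacedBounded p s) (hv : v ∈ s.dirty) :
    s.deficit p v ≤ threshold p (Fintype.card V) #s.dirty := by
  linarith [placed_add_deficit p s v, (h v hv).1]

theorem PlacedBounded.totalDeficit_le [Fintype V] (h : PlacedBounded p s) :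
    totalDeficit p s ≤ #s.dirty * threshold p (Fintype.card V) #s.dirty :=
  (sum_le_card_nsmul _ _ _ fun _ hv ↦ h.deficit_le hv).trans_eq (nsmul_eq_mul _ _)

theorem PlacedBounded.totalDeficit_le_mul_sq [Fintype V] (hp : 0 ≤ p) (h : PlacedBounded p s) :
    totalDeficit p s ≤ p * #s.dirty ^ 2 := by
  have hcard : (#s.dirty : ℝ) ≤ Fintype.card V := by exact_mod_cast card_le_univ _
  have hthreshold : threshold p (Fintype.card V) #s.dirty ≤ p * #s.dirty := by
    unfold threshold
    gcongr
    linarith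
  calc totalDeficit p s ≤ #s.dirty * threshold p (Fintype.card V) #s.dirty := h.totalDeficit_le
    _ ≤ #s.dirty * (p * #s.dirty) := by gcongr
    _ = p * #s.dirty ^ 2 := by ring

theorem PlacedBounded.exists_turnBound_le [Fintype V] (hp : 0 < p) (h : PlacedBounded p s)
    (hs : s.dirty.Nonempty) (hpos : ∀ v ∈ s.dirty, 0 < s.deficit p v) (P : Player) :
    ∃ v ∈ s.dirty, turnBound p P s v ≤ potential p s + 6 * p + 1 := by
  obtain ⟨a, ha⟩ : ∃ a, #s.dirty = a + 1 := Nat.exists_eq_succ_of_ne_zero hs.card_ne_zero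
  have hsq := h.totalDeficit_le_mul_sq hp.le
  obtain ⟨v, hv, hmean⟩ : ∃ v ∈ s.dirty, s.deficit p v ≤ totalDeficit p s / (a + 1) := by
    refine exists_le_of_sum_le hs ?_
    rw [sum_const, nsmul_eq_mul, ha, Nat.cast_succ, mul_div_cancel₀ _ (by positivity), totalDeficit]
  refine ⟨v, hv, (turnBound_le_max hp P s v).trans ?_⟩
  rw [ha, Nat.cast_succ] at hsq
  have hnonneg : 0 ≤ totalDeficit p s := sum_nonneg fun v hv ↦ (hpos v hv).le
  have := targetValue_le_value_add hp hnonneg hsq hmean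
  unfold potential
  rw [ha, Nat.add_sub_cancel]
  linarith

theorem potential_initial_le [Fintype V] (hp : 0 < p) :
    potential p (initial V) ≤
      p * Fintype.card V ^ 2 * Real.exp (-1) + (6 * p + 3) * Fintype.card V := by
  have htotal : totalDeficit p (initial V) ≤ p * Fintype.card V ^ 2 := by
    simp only [totalDeficit, deficit, initial, sum_const, card_univ, nsmul_eq_mul, Pi.zero_apply]
    nlinarith [mul_nonneg hp.le (Nat.cast_nonneg (α := ℝ) (Fintype.card V))]
  unfold potential value
  rw [dirty_initial, card_univ, ← rescaledValue_one]
  gcongr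
  exact rescaledValue_monotone (div_le_one_of_le₀ htotal (by positivity))

variable [DecidableEq V]

theorem totalDeficit_place (p : ℝ) (hv : v ∈ s.dirty) :
    totalDeficit p (s.place v) = totalDeficit p s - 1 := by
  have hrest : ∑ w ∈ s.dirty.erase v, (s.place v).deficit p w =
      ∑ w ∈ s.dirty.erase v, s.deficit p w :=
    sum_congr rfl fun w hw ↦ deficit_place_of_ne p s (ne_of_mem_erase hw)
  have hself := deficit_place_self p s v
  calc totalDeficit p (s.place v)
      = ∑ w ∈ s.dirty.erase v, (s.place v).deficit p w + (s.place v).deficit p v :=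
        (sum_erase_add s.dirty _ hv).symm
    _ = ∑ w ∈ s.dirty.erase v, s.deficit p w + s.deficit p v - 1 := by rw [hrest, hself, add_sub]
    _ = totalDeficit p s - 1 := by rw [sum_erase_add _ _ hv, totalDeficit]

theorem totalDeficit_fire (hv : v ∈ s.dirty) : totalDeficit p (s.fire p ⊤ v) =
    totalDeficit p s - s.deficit p v - 2 * p * #(s.fire p ⊤ v).dirty := by
  have hrest : totalDeficit p (s.fire p ⊤ v) =
      ∑ w ∈ s.dirty.erase v, (s.deficit p w - 2 * p) :=
    sum_congr rfl fun w hw ↦ deficit_fire_top hv hw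
  rw [hrest, sum_sub_distrib, sum_const, nsmul_eq_mul, totalDeficit, ← sum_erase_add _ _ hv]
  simp only [fire]
  ring

theorem turnBound_place_self (hv : v ∈ s.dirty) :
    turnBound p .max (s.place v) v = turnBound p .min s v - 1 := by
  simp only [turnBound, targetValue, dirty_place, totalDeficit_place p hv, deficit_place_self]
  ring_nf

theorem turnBound_place_le (hp : 0 < p) (hw : w ∈ s.dirty) :
    turnBound p .min (s.place w) v ≤ turnBound p .max s v - 1 := by
  have hdeficit : (s.place w).deficit p v ≤ s.deficit p v := by
    rcases eq_or_ne v w with rfl | h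
    · linarith [deficit_place_self p s v]
    · exact (deficit_place_of_ne p s h).le
  have := targetValue_monotone hp (#s.dirty - 1) (totalDeficit p s - 1) hdeficit
  simp only [turnBound, dirty_place, totalDeficit_place p hw]
  linarith

theorem potential_fire_le_turnBound (hp : 0 < p) (P : Player) (hu : u ∈ s.dirty)
    (hud : -1 ≤ s.deficit p u) (hvd : -1 ≤ s.deficit p v) :
    potential p (s.fire p ⊤ u) ≤ turnBound p P s v - 6 * p - 1 := by
  have hcard : #(s.fire p ⊤ u).dirty + 1 = #s.dirty := card_dirty_fire_add_one hu
  set a := #(s.fire p ⊤ u).dirty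
  have htarget : value p a (totalDeficit p (s.fire p ⊤ u)) ≤
      targetValue p a (totalDeficit p s - 1) (-1) + 2 := by
    rw [totalDeficit_fire hu, targetValue]
    refine (value_monotone hp a ?_).trans_eq (by ring)
    linarith
  have hmin := targetValue_monotone hp a (totalDeficit p s - 1) hvd
  have hmax := targetValue_le_targetValue hp a (sub_le_self (totalDeficit p s) zero_le_one)
    (s.deficit p v)
  unfold potential turnBound
  rw [← hcard, Nat.add_sub_cancel, Nat.cast_succ]
  cases P <;> simp only <;> linarith

namespace PlacedBounded

variable [Fintype V]

theorem fire (h : PlacedBounded p s) (hv : v ∈ s.dirty) : PlacedBounded p (s.fire p ⊤ v) := by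
  intro w hw
  rw [placed_fire_top hv hw]
  exact h w (mem_of_mem_erase hw)

theorem place (hp : 0 ≤ p) (h : PlacedBounded p s) (hw : w ∈ s.dirty) (hpos : 0 < s.deficit p w) :
    PlacedBounded p (s.place w) := by
  intro v hv
  have hcard : (#s.dirty : ℝ) ≤ Fintype.card V := by exact_mod_cast card_le_univ _
  rw [placed_place, Pi.add_apply, Pi.single_apply]
  split_ifs with hvw
  · subst hvw
    have := placed_add_deficit p s v
    unfold threshold at this
    constructor
    · linarith [(h v hv).1]
    · nlinarith
  · rw [add_zero]
    exact h v hv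

theorem value_fire_le (hp : 0 < p) (h : PlacedBounded p s) (hv : v ∈ s.dirty) :
    value p #(s.fire p ⊤ v).dirty (totalDeficit p (s.fire p ⊤ v)) ≤
      value p #s.dirty (totalDeficit p s) + 1 := by
  have hcard : #(s.fire p ⊤ v).dirty + 1 = #s.dirty := card_dirty_fire_add_one hv
  have htotal := totalDeficit_fire (p := p) hv
  have hfired := (h.fire hv).totalDeficit_le
  have hbefore := h.totalDeficit_le
  have hdeficit := placed_add_deficit p s v
  set m := #(s.fire p ⊤ v).dirty
  rw [← hcard, threshold, Nat.cast_succ] at hbefore hdeficit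
  rw [← hcard]
  rcases le_or_gt (Fintype.card V : ℝ) (2 * m + 1) with hn | hn
  · rw [htotal, sub_right_comm, sub_eq_add_neg _ (deficit p s v)]
    refine value_le_value_succ_add_one hp ?_
    have hmax : max (totalDeficit p s) 0 ≤ (m + 1) * (p * (2 * m + 1 - Fintype.card V)) := by
      refine max_le (by linarith) ?_
      have := sub_nonneg.mpr hn
      positivity
    nlinarith [(h v hv).2]
  · have hnonpos : totalDeficit p (s.fire p ⊤ v) ≤ 0 := by
      refine hfired.trans (mul_nonpos_of_nonneg_of_nonpos m.cast_nonneg ?_)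
      exact mul_nonpos_of_nonneg_of_nonpos hp.le (by linarith)
    rw [value_of_nonpos hp m hnonpos]
    linarith [value_nonneg hp (m + 1) (totalDeficit p s)]

theorem potential_fire_le (hp : 0 < p) (h : PlacedBounded p s) (hv : v ∈ s.dirty) :
    potential p (s.fire p ⊤ v) ≤ potential p s := by
  have hcard : (#(s.fire p ⊤ v).dirty + 1 : ℝ) = #s.dirty := by
    exact_mod_cast card_dirty_fire_add_one hv
  have := h.value_fire_le hp hv
  unfold potential
  rw [← hcard]
  linarith

theorem stabilize (hp : 0 < p) (h : PlacedBounded p s) : PlacedBounded p (s.stabilize p ⊤) ∧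
    potential p (s.stabilize p ⊤) ≤ potential p s :=
  stabilize_induction (C := fun s' ↦ PlacedBounded p s' ∧ potential p s' ≤ potential p s)
    (fun _ _ hs hv ↦ ⟨hs.1.fire hv.1, (hs.1.potential_fire_le hp hv.1).trans hs.2⟩) s ⟨h, le_rfl⟩

end PlacedBounded

theorem deficit_pos_of_forall_not_ready (hs : ∀ v, ¬ s.Ready p ⊤ v) (hv : v ∈ s.dirty) :
    0 < s.deficit p v :=
  not_le.mp fun h ↦ hs v (ready_top_iff.mpr ⟨hv, h⟩)

variable [Fintype V]

theorem PlacedBounded.exists_turnBound_stabilize_le (hp : 0 < p) (h : PlacedBounded p s)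
    (P : Player) (hempty : (s.stabilize p ⊤).dirty ≠ ∅) :
    ∃ v ∈ (s.stabilize p ⊤).dirty,
      turnBound p P (s.stabilize p ⊤) v ≤ potential p s + 6 * p + 1 := by
  obtain ⟨hbounded, hpotential⟩ := h.stabilize hp
  obtain ⟨v, hv, hle⟩ := hbounded.exists_turnBound_le hp (nonempty_iff_ne_empty.mpr hempty)
    (fun v ↦ deficit_pos_of_forall_not_ready (stabilize_spec p hp.le ⊤ s).1) P
  exact ⟨v, hv, hle.trans (by gcongr)⟩

theorem PlacedBounded.exists_turnBound_move_le (hp : 0 < p) (h : PlacedBounded p s)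
    (hs : ∀ u, ¬ s.Ready p ⊤ u) (hv : v ∈ s.dirty) (hw : w ∈ s.dirty) (P : Player)
    (hempty : (s.move p ⊤ w).dirty ≠ ∅) :
    ∃ u ∈ (s.move p ⊤ w).dirty, turnBound p P (s.move p ⊤ w) u ≤ turnBound p P (s.place w) v := by
  have hdeficit : ∀ u ∈ s.dirty, -1 ≤ (s.place w).deficit p u := by
    intro u hu
    have hpos := deficit_pos_of_forall_not_ready hs hu
    rcases eq_or_ne u w with rfl | huw
    · linarith [deficit_place_self p s u]
    · linarith [deficit_place_of_ne p s huw]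
  have hplace := h.place hp.le hw (deficit_pos_of_forall_not_ready hs hw)
  unfold move at *
  rw [BrushPosition.stabilize] at hempty ⊢
  split_ifs at hempty ⊢ with hready
  · have hu := hready.choose_spec.1
    obtain ⟨u, hu', hle⟩ := (hplace.fire hu).exists_turnBound_stabilize_le hp P hempty
    have := potential_fire_le_turnBound hp P hu (hdeficit _ hu) (hdeficit v hv)
    exact ⟨u, hu', by linarith⟩
  · exact ⟨v, hv, le_rfl⟩

theorem minForces_of_turnBound_le (hp : 0 < p) (k : ℕ) : ∀ (P : Player) (s : BrushPosition V),
    (∀ v, ¬ s.Ready p ⊤ v) → PlacedBounded p s →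
      (s.dirty ≠ ∅ → ∃ v ∈ s.dirty, turnBound p P s v ≤ k) → MinForces p ⊤ k P s := by
  induction k with
  | zero =>
    intro P s hs _ hbound
    by_contra hempty
    obtain ⟨v, hv, hle⟩ := hbound hempty
    exact (turnBound_pos hp P (deficit_pos_of_forall_not_ready hs hv)).not_ge (by simpa using hle)
  | succ k ih =>
    intro P s hs h hbound
    by_cases hempty : s.dirty = ∅
    · cases P <;> exact Or.inl hempty
    obtain ⟨v, hv, hle⟩ := hbound hempty
    push_cast at hle
    have hmove : ∀ P w, w ∈ s.dirty → turnBound p P (s.place w) v ≤ k →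
        MinForces p ⊤ k P (s.move p ⊤ w) := by
      intro P w hw hk
      refine ih P _ (stabilize_spec p hp.le ⊤ _).1
        ((h.place hp.le hw (deficit_pos_of_forall_not_ready hs hw)).stabilize hp).1 fun hne ↦ ?_
      obtain ⟨u, hu, hu'⟩ := h.exists_turnBound_move_le hp hs hv hw P hne
      exact ⟨u, hu, hu'.trans hk⟩
    cases P with
    | min => exact Or.inr ⟨v, hv, hmove _ v hv (by linarith [turnBound_place_self (p := p) hv])⟩
    | max => exact Or.inr fun w hw ↦ hmove _ w hw (by linarith [turnBound_place_le (v := v) hp hw])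

theorem fractionalGameBrushNumber_top_le (hp : 0 < p) :
    fractionalGameBrushNumber p (⊤ : SimpleGraph V) ≤
      p * Fintype.card V ^ 2 * Real.exp (-1) + (6 * p + 3) * Fintype.card V + 6 * p + 2 := by
  have hbounded : PlacedBounded p (initial V) := by
    rintro v -
    have hcard : (1 : ℝ) ≤ Fintype.card V := by exact_mod_cast Fintype.card_pos_iff.mpr ⟨v⟩
    rw [placed_initial, Pi.zero_apply]
    exact ⟨le_rfl, by nlinarith⟩
  set B := p * Fintype.card V ^ 2 * Real.exp (-1) + (6 * p + 3) * Fintype.card V + 6 * p + 1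
  have hforces : MinForces p (⊤ : SimpleGraph V) ⌈B⌉₊ .min (start p ⊤) := by
    rw [start_eq_stabilize_initial]
    refine minForces_of_turnBound_le hp _ _ _ (stabilize_spec p hp.le ⊤ _).1
      (hbounded.stabilize hp).1 fun hempty ↦ ?_
    obtain ⟨v, hv, hle⟩ := hbounded.exists_turnBound_stabilize_le hp .min hempty
    exact ⟨v, hv, by linarith [potential_initial_le (V := V) hp, Nat.le_ceil B]⟩
  calc (fractionalGameBrushNumber p (⊤ : SimpleGraph V) : ℝ) ≤ ⌈B⌉₊ := by
        exact_mod_cast Nat.sInf_le hforces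
    _ ≤ B + 1 := (Nat.ceil_lt_add_one (by positivity)).le
    _ = _ := by ring

end MinStrategy

end BrushPosition

/-! ### Asymptotics -/

section Asymptotics

open Filter Topology

section Bounds

variable {V : Type*} [Fintype V] [DecidableEq V] {p : ℝ}

theorem le_fractionalGameBrushNumber_top_div (hp : 0 < p) {q : ℕ} (hq : 1 ≤ q)
    (hqn : q ≤ Fintype.card V) :
    2 * q * (q + 1) * Real.log ((Fintype.card V + 2) / (q + 2)) / (Fintype.card V : ℝ) ^ 2 -
        2 * (Fintype.card V * p)⁻¹ - (Fintype.card V * p)⁻¹ * (Fintype.card V : ℝ)⁻¹ ≤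
      fractionalGameBrushNumber p (⊤ : SimpleGraph V) / (p * (Fintype.card V : ℝ) ^ 2) := by
  have : (0 : ℝ) < Fintype.card V := by exact_mod_cast hq.trans hqn
  rw [le_div_iff₀ (by positivity)]
  refine le_of_eq_of_le ?_ (BrushPosition.le_fractionalGameBrushNumber_top hp.le hq hqn)
  field_simp

theorem fractionalGameBrushNumber_top_div_le [Nonempty V] (hp : 0 < p) :
    fractionalGameBrushNumber p (⊤ : SimpleGraph V) / (p * (Fintype.card V : ℝ) ^ 2) ≤
      Real.exp (-1) + (6 * (Fintype.card V : ℝ)⁻¹ + 3 * (Fintype.card V * p)⁻¹ +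
        6 * (Fintype.card V : ℝ)⁻¹ ^ 2 +
          2 * ((Fintype.card V * p)⁻¹ * (Fintype.card V : ℝ)⁻¹)) := by
  have : (0 : ℝ) < Fintype.card V := by exact_mod_cast Fintype.card_pos
  rw [div_le_iff₀ (by positivity)]
  refine (BrushPosition.fractionalGameBrushNumber_top_le (V := V) hp).trans_eq ?_
  field_simp
  ring

end Bounds

theorem tendsto_two_mul_floor_mul_log {c : ℝ} (hc : 0 < c) :
    Tendsto (fun n : ℕ ↦ 2 * ⌊c * n⌋₊ * (⌊c * n⌋₊ + 1) *
      Real.log ((n + 2) / (⌊c * n⌋₊ + 2)) / (n : ℝ) ^ 2) atTop (𝓝 (2 * c ^ 2 * Real.log c⁻¹)) := by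
  have hinv : Tendsto (fun n : ℕ ↦ (n : ℝ)⁻¹) atTop (𝓝 0) := tendsto_inv_atTop_nhds_zero_nat
  have hfloor : Tendsto (fun n : ℕ ↦ (⌊c * n⌋₊ : ℝ) / n) atTop (𝓝 c) :=
    (tendsto_nat_floor_mul_div_atTop hc.le).comp tendsto_natCast_atTop_atTop
  have hnum : Tendsto (fun n : ℕ ↦ 1 + 2 * (n : ℝ)⁻¹) atTop (𝓝 1) := by
    simpa using (hinv.const_mul 2).const_add 1
  have hden : Tendsto (fun n : ℕ ↦ (⌊c * n⌋₊ : ℝ) / n + 2 * (n : ℝ)⁻¹) atTop (𝓝 c) := by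
    simpa using hfloor.add (hinv.const_mul 2)
  have hlog := (hnum.div hden hc.ne').log (div_ne_zero one_ne_zero hc.ne')
  have hlim := ((hfloor.const_mul 2).mul (hfloor.add hinv)).mul hlog
  rw [add_zero, one_div, mul_assoc 2 c c, ← sq] at hlim
  refine hlim.congr' ?_
  filter_upwards [eventually_gt_atTop 0] with n hn
  have : (0 : ℝ) < n := by exact_mod_cast hn
  have hratio : (1 + 2 * (n : ℝ)⁻¹) / ((⌊c * n⌋₊ : ℝ) / n + 2 * (n : ℝ)⁻¹) =
      (n + 2) / (⌊c * n⌋₊ + 2) := by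
    field_simp
  rw [Pi.div_apply, hratio]
  field_simp

theorem tendsto_fractionalGameBrushNumber_top_div {p : ℕ → ℝ}
    (hp : Tendsto (fun n : ℕ ↦ n * p n) atTop atTop) :
    Tendsto (fun n : ℕ ↦ (fractionalGameBrushNumber (p n) (⊤ : SimpleGraph (Fin n)) : ℝ) /
      (p n * n ^ 2)) atTop (𝓝 (Real.exp (-1))) := by
  -- The limit `2 * c ^ 2 * log c⁻¹` of the lower bounds is largest at this `c`.
  set c := Real.exp (-1 / 2) with hc
  have hcpos : 0 < c := Real.exp_pos _
  have hinv : Tendsto (fun n : ℕ ↦ (n : ℝ)⁻¹) atTop (𝓝 0) := tendsto_inv_atTop_nhds_zero_nat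
  have hpinv : Tendsto (fun n : ℕ ↦ (n * p n)⁻¹) atTop (𝓝 0) := tendsto_inv_atTop_zero.comp hp
  have hlower := ((tendsto_two_mul_floor_mul_log hcpos).sub
    (hpinv.const_mul 2)).sub (hpinv.mul hinv)
  have hupper := ((((hinv.const_mul 6).add (hpinv.const_mul 3)).add
    ((hinv.pow 2).const_mul 6)).add ((hpinv.mul hinv).const_mul 2)).const_add (Real.exp (-1))
  have hmax : 2 * c ^ 2 * Real.log c⁻¹ = Real.exp (-1) := by
    rw [Real.log_inv, hc, Real.log_exp, ← Real.exp_nat_mul]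
    norm_num
    ring
  simp only [hmax, mul_zero, sub_zero] at hlower
  simp only [ne_eq, OfNat.ofNat_ne_zero, not_false_eq_true, zero_pow, mul_zero, add_zero] at hupper
  have hpos : ∀ᶠ n : ℕ in atTop, 0 < n ∧ 0 < p n := by
    filter_upwards [hp.eventually_gt_atTop 0, eventually_gt_atTop 0] with n hnp hn
    exact ⟨hn, pos_of_mul_pos_right hnp n.cast_nonneg⟩
  have hfloor : ∀ᶠ n : ℕ in atTop, 1 ≤ ⌊c * n⌋₊ :=
    (tendsto_nat_floor_atTop.comp
      (tendsto_natCast_atTop_atTop.const_mul_atTop hcpos)).eventually_ge_atTop 1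
  refine tendsto_of_tendsto_of_tendsto_of_le_of_le' hlower hupper ?_ ?_
  · filter_upwards [hpos, hfloor] with n ⟨_, hpn⟩ hq
    have hqn : ⌊c * n⌋₊ ≤ n :=
      Nat.floor_le_of_le <| mul_le_of_le_one_left n.cast_nonneg <|
        Real.exp_le_one_iff.mpr (by norm_num)
    simpa only [Fintype.card_fin] using
      le_fractionalGameBrushNumber_top_div (V := Fin n) hpn hq (by rwa [Fintype.card_fin])
  · filter_upwards [hpos] with n ⟨hn, hpn⟩
    have : NeZero n := ⟨hn.ne'⟩
    simpa only [Fintype.card_fin] using fractionalGameBrushNumber_top_div_le (V := Fin n) hpn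

theorem isEquivalent_fractionalGameBrushNumber_top {p : ℕ → ℝ}
    (hp : Tendsto (fun n : ℕ ↦ n * p n) atTop atTop) :
    Asymptotics.IsEquivalent atTop
      (fun n : ℕ ↦ (fractionalGameBrushNumber (p n) (⊤ : SimpleGraph (Fin n)) : ℝ))
      (fun n : ℕ ↦ p n * (n : ℝ) ^ 2 / Real.exp 1) := by
  refine Asymptotics.isEquivalent_of_tendsto_one ?_
  have h := (tendsto_fractionalGameBrushNumber_top_div hp).mul_const (Real.exp 1)
  rw [← Real.exp_add, neg_add_cancel, Real.exp_zero] at h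
  refine h.congr fun n ↦ ?_
  rw [Pi.div_apply, div_div_eq_mul_div, div_mul_eq_mul_div]

theorem tendsto_mul_atTop_of_log_div_isLittleO {p : ℕ → ℝ} (hp : ∀ n, 0 < p n)
    (hlog : Asymptotics.IsLittleO atTop (fun n : ℕ ↦ Real.log n / n) p) :
    Tendsto (fun n : ℕ ↦ n * p n) atTop atTop := by
  refine tendsto_atTop_mono' _ ?_ (Real.tendsto_log_atTop.comp tendsto_natCast_atTop_atTop)
  filter_upwards [hlog.def one_pos, eventually_gt_atTop 0] with n hle hn
  have hn' : (0 : ℝ) < n := by exact_mod_cast hn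
  rw [one_mul, Real.norm_of_nonneg (hp n).le] at hle
  exact (div_le_iff₀' hn').mp ((Real.le_norm_self _).trans hle)

end Asymptotics

theorem mainTheorem7_general (p : ℕ → ℝ)
    (hp : Filter.Tendsto (fun n : ℕ ↦ n * p n) Filter.atTop Filter.atTop) :
    Asymptotics.IsEquivalent Filter.atTop
        (fun n : ℕ ↦ (fractionalGameBrushNumber (p n) (⊤ : SimpleGraph (Fin n)) : ℝ))
        (fun n : ℕ ↦ p n * (gameBrushNumber (⊤ : SimpleGraph (Fin n)) : ℝ)) ∧
      Asymptotics.IsEquivalent Filter.atTop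
        (fun n : ℕ ↦ (fractionalGameBrushNumber (p n) (⊤ : SimpleGraph (Fin n)) : ℝ))
        (fun n : ℕ ↦ p n * (n : ℝ) ^ 2 / Real.exp 1) := by
  have hfractional := isEquivalent_fractionalGameBrushNumber_top hp
  have hordinary : Asymptotics.IsEquivalent Filter.atTop
      (fun n : ℕ ↦ (gameBrushNumber (⊤ : SimpleGraph (Fin n)) : ℝ))
      (fun n : ℕ ↦ 1 * (n : ℝ) ^ 2 / Real.exp 1) :=
    isEquivalent_fractionalGameBrushNumber_top (p := fun _ ↦ 1)
      (by simpa using tendsto_natCast_atTop_atTop)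
  refine ⟨hfractional.trans (.symm ?_), hfractional⟩
  simpa only [Pi.mul_def, one_mul, mul_div_assoc] using
    (Asymptotics.IsEquivalent.refl (u := p)).mul hordinary

theorem mainTheorem7 (p : ℕ → ℝ) (hp : ∀ n, 0 < p n)
    (hlog : Asymptotics.IsLittleO Filter.atTop (fun n : ℕ => Real.log n / n) p) :
    Asymptotics.IsEquivalent Filter.atTop
        (fun n : ℕ => (fractionalGameBrushNumber (p n) (⊤ : SimpleGraph (Fin n)) : ℝ))
        (fun n : ℕ => p n * (gameBrushNumber (⊤ : SimpleGraph (Fin n)) : ℝ)) ∧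
      Asymptotics.IsEquivalent Filter.atTop
        (fun n : ℕ => (fractionalGameBrushNumber (p n) (⊤ : SimpleGraph (Fin n)) : ℝ))
        (fun n : ℕ => p n * (n : ℝ) ^ 2 / Real.exp 1) :=
  mainTheorem7_general p (tendsto_mul_atTop_of_log_div_isLittleO hp hlog)
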